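/- All graphs are finite undirected graphs without loops; parallel edges are allowed. For a graph $G$ with vertex set $V(G)$, $v(G)=n\ge 1$ vertices, let $L(G)=D(G)-A(G)$ be its Laplacian matrix, where $D(G)$ is the diagonal matrix of the vertex degrees and $A(G)$ is the matrix with zero diagonal whose off-diagonal $(u,w)$ entry is the number of edges between $u$ and $w$. Then $\det(\lambda I-L(G))=\lambda P(\lambda,G)$ for a polynomial $P(\lambda,G)$ of degree $n-1$ (the Laplacian polynomial of $G$), and the coefficients $c_s(G)$ are defined by $$P(\lambda,G)=\sum_{s=0}^{n-1}(-1)^s c_s(G)\,\lambda^{n-1-s}.$$ Let $x\ne y$ be vertices of $G$, let $\mathcal K$ be an induced subgraph of $G$ containing $x$ and $y$, and let $N_z(G)$ denote the set of neighbours of a vertex $z$ in $G$. Put $$X=N_x(G)\setminus (V(\mathcal K)\cup N_y(G)),\qquad Y=N_y(G)\setminus (V(\mathcal K)\cup N_x(G)).$$ For a vertex $z$ and a set $Z$ of vertices let $[z,Z]$ denote the set of edges between $z$ and vertices of $Z$. The graph $\mathcal K_{xy}(G)$ obtained from $G$ by the $\mathcal K_{xy}$-operation is the graph obtained by replacing every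 edge between $x$ and a vertex $w\in X$ by an edge between $y$ and $w$. The operation is called symmetric if the graph $G-([x,X]\cup[y,Y])$ has an automorphism $\alpha$ such that $\alpha(x)=y$, $\alpha(y)=x$, $\alpha(z)\in V(\mathcal K)$ for every $z\in V(\mathcal K)$, and $\alpha(v)=v$ for every $v\in X\cup Y$. **Theorem.** If $G'=\mathcal K_{xy}(G)$ is obtained from a graph $G$ by a symmetric $\mathcal K_{xy}$-operation, then $c_s(G)\ge c_s(G')$ for every $s\in\{0,\dots,v(G)-1\}$. -/

import Mathlib

open scoped Graph

namespace Graph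

/-! Graphs are Mathlib's multigraphs `Graph α β` (parallel edges allowed); the graphs considered
below are finite and have no loops. -/

section Laplacian

variable {α β : Type*}

/-- The degree of a vertex: the number of edges incident to it. -/
noncomputable def vertexDegree (G : Graph α β) (v : α) : ℕ := (G.incidenceSet v).ncard

/-- The number of parallel edges with end-vertices `u` and `v`. -/
noncomputable def multiplicity (G : Graph α β) (u v : α) : ℕ := {e : β | G.IsLink e u v}.ncard

open Classical in
/-- The Laplacian matrix `L(G) = D(G) - A(G)`, where `D(G)` is the diagonal matrix of the degrees,
and `A(G)` has zero diagonal and the numbers of parallel edges off the diagonal. -/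
noncomputable def laplacianMatrix (G : Graph α β) : Matrix V(G) V(G) ℝ :=
  Matrix.diagonal (fun v : V(G) => (G.vertexDegree v : ℝ)) -
    Matrix.of (fun u v : V(G) => if u = v then 0 else (G.multiplicity u v : ℝ))

open Classical in
/-- `L(λ, G) = det (λ I - L(G))`. -/
noncomputable def laplacianCharpoly (G : Graph α β) [Finite V(G)] : Polynomial ℝ :=
  letI := Fintype.ofFinite V(G)
  G.laplacianMatrix.charpoly

/-- The Laplacian polynomial `P(λ, G) = L(λ, G) / λ`
(the division is exact, see `X_mul_laplacianPolynomial`). -/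
noncomputable def laplacianPolynomial (G : Graph α β) [Finite V(G)] : Polynomial ℝ :=
  G.laplacianCharpoly.divX

/-- The coefficients `c_s(G)`, `0 ≤ s ≤ n - 1`, where `n` is the number of vertices of `G`, of
`P(λ, G) = ∑ (-1)^s c_s(G) λ^(n - 1 - s)`. -/
noncomputable def laplacianCoeff (G : Graph α β) [Finite V(G)] (s : ℕ) : ℝ :=
  (-1) ^ s * G.laplacianPolynomial.coeff (V(G).ncard - 1 - s)

/-- In a finite loopless graph the degree of `u` is the sum of the multiplicities at `u`. -/
theorem sum_multiplicity (G : Graph α β) [G.Loopless] [Fintype V(G)] (hE : E(G).Finite)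
    (u : V(G)) : ∑ v : V(G), G.multiplicity u v = G.vertexDegree u := by
  classical
  have h : G.incidenceSet (u : α) = ⋃ v : V(G), {e : β | G.IsLink e u v} := by
    ext e
    simp only [Graph.incidenceSet, Graph.Inc, Set.mem_ofPred_eq, Set.mem_iUnion]
    exact ⟨fun ⟨y, hy⟩ => ⟨⟨y, hy.right_mem⟩, hy⟩, fun ⟨y, hy⟩ => ⟨y, hy⟩⟩
  have hf : ∀ v : V(G), {e : β | G.IsLink e u v}.Finite := fun v =>
    hE.subset fun e he => Graph.IsLink.edge_mem he
  rw [Graph.vertexDegree, h, Set.ncard_iUnion_of_finite hf]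
  · rw [finsum_eq_sum_of_fintype]; rfl
  · intro v w hvw
    refine Set.disjoint_left.2 fun e he he' => hvw ?_
    exact Subtype.ext (Graph.IsLink.right_unique he he')

theorem X_mul_laplacianPolynomial (G : Graph α β) [G.Loopless] [Finite V(G)] (hE : E(G).Finite)
    (hV : V(G).Nonempty) :
    Polynomial.X * G.laplacianPolynomial = G.laplacianCharpoly := by
  classical
  let _ := Fintype.ofFinite V(G)
  have hdet : G.laplacianMatrix.det = 0 := by
    rw [← Matrix.exists_mulVec_eq_zero_iff]
    obtain ⟨v, hv⟩ := hV
    refine ⟨fun _ => 1, fun h => one_ne_zero (congrFun h ⟨v, hv⟩), ?_⟩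
    ext u
    have hz : G.multiplicity u u = 0 := by
      simp [Graph.multiplicity]
    have h1 : ∀ w : V(G), (if u = w then (0 : ℝ) else (G.multiplicity u w : ℝ))
        = (G.multiplicity u w : ℝ) := by
      intro w
      split_ifs with h
      · subst h; simp [hz]
      · rfl
    simp only [laplacianMatrix, Matrix.mulVec, dotProduct, Matrix.sub_apply, Matrix.of_apply, h1,
      mul_one, Finset.sum_sub_distrib, Matrix.diagonal_apply, Finset.sum_ite_eq,
      Finset.mem_univ, if_true, Pi.zero_apply]
    rw [← sum_multiplicity G hE u]
    push_cast
    exact sub_self _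
  have h0 : G.laplacianCharpoly.coeff 0 = 0 := by
    have h2 := Matrix.det_eq_sign_charpoly_coeff G.laplacianMatrix
    rw [hdet] at h2
    have h3 : G.laplacianMatrix.charpoly.coeff 0 = 0 := by
      rcases mul_eq_zero.1 h2.symm with h | h
      · exact absurd h (pow_ne_zero _ (by norm_num))
      · exact h
    unfold laplacianCharpoly
    convert h3
  have h := Polynomial.X_mul_divX_add G.laplacianCharpoly
  rw [h0, map_zero, add_zero] at h
  exact h

end Laplacian

section KOperation

variable {α β : Type*}

/-- `[A, B]`: the set of edges with one end-vertex in `A` and the other in `B`. -/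
def edgesBetween (G : Graph α β) (A B : Set α) : Set β := {e | ∃ u ∈ A, ∃ v ∈ B, G.IsLink e u v}

/-- `N_x(G) \ (V(K) ∪ N_y(G))`: the neighbours of `x` that lie outside `K` and are not neighbours
of `y`. With this, `X = G.privateNbrs K x y` and `Y = G.privateNbrs K y x`. -/
def privateNbrs (G K : Graph α β) (x y : α) : Set α :=
  {v | G.Adj x v} \ (V(K) ∪ {v | G.Adj y v})

/-- The result `(G - [x,X]) ∪ [y,X]` of the `K_{xy}`-operation on `G`, where
`X = N_x(G) \ (V(K) ∪ N_y(G))`: every edge `e` between `x` and some `w ∈ X` is replaced by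
an edge (again labelled `e`) between `y` and `w`; all the other edges are kept. -/
def kOperation (G K : Graph α β) (x y : α) (hy : y ∈ V(G)) : Graph α β where
  vertexSet := V(G)
  edgeSet := E(G)
  IsLink e u v :=
    (e ∉ G.edgesBetween {x} (G.privateNbrs K x y) ∧ G.IsLink e u v) ∨
    ∃ w ∈ G.privateNbrs K x y, G.IsLink e x w ∧ ((u = y ∧ v = w) ∨ (u = w ∧ v = y))
  isLink_symm e _ := ⟨by
    rintro u v (⟨h, h'⟩ | ⟨w, hw, h, h'⟩)
    · exact Or.inl ⟨h, h'.symm⟩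
    · exact Or.inr ⟨w, hw, h, by tauto⟩⟩
  eq_or_eq_of_isLink_of_isLink := by
    rintro e a b c d (⟨h, h'⟩ | ⟨w, hw, h, h'⟩) (⟨k, k'⟩ | ⟨z, hz, k, k'⟩)
    · exact h'.left_eq_or_eq k'
    · exact absurd ⟨x, rfl, z, hz, k⟩ h
    · exact absurd ⟨x, rfl, w, hw, h⟩ k
    · obtain rfl := h.right_unique k
      rcases h' with ⟨rfl, rfl⟩ | ⟨rfl, rfl⟩ <;> rcases k' with ⟨rfl, rfl⟩ | ⟨rfl, rfl⟩ <;> simp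
  edge_mem_iff_exists_isLink e := by
    constructor
    · intro he
      by_cases h : e ∈ G.edgesBetween {x} (G.privateNbrs K x y)
      · obtain ⟨u, rfl, w, hw, h⟩ := h
        exact ⟨y, w, Or.inr ⟨w, hw, h, Or.inl ⟨rfl, rfl⟩⟩⟩
      · obtain ⟨u, v, huv⟩ := G.exists_isLink_of_mem_edgeSet he
        exact ⟨u, v, Or.inl ⟨h, huv⟩⟩
    · rintro ⟨u, v, ⟨_, h⟩ | ⟨w, _, h, _⟩⟩ <;> exact h.edge_mem
  left_mem_of_isLink := by
    rintro e u v (⟨_, h⟩ | ⟨w, _, h, ⟨rfl, _⟩ | ⟨rfl, _⟩⟩)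
    · exact h.left_mem
    · exact hy
    · exact h.right_mem

instance (G K : Graph α β) (x y : α) (hy : y ∈ V(G)) [h : Finite V(G)] :
    Finite V(G.kOperation K x y hy) := h

/-- The vertex map `f` is an automorphism of `H`: it permutes the vertices of `H`, and together with
some permutation `g` of the edges of `H` it preserves incidence. (The values of `f` and `g` outside
of the vertex set and of the edge set play no role.) -/
def IsAutomorphism (H : Graph α β) (f : α → α) : Prop :=
  Set.BijOn f V(H) V(H) ∧
    ∃ g : β → β, Set.BijOn g E(H) E(H) ∧
      ∀ e ∈ E(H), ∀ u ∈ V(H), ∀ v ∈ V(H), H.IsLink e u v ↔ H.IsLink (g e) (f u) (f v)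

/-- The `K_{xy}`-operation on `G` is symmetric: `G - ([x,X] ∪ [y,Y])` has an automorphism that
swaps `x` and `y`, maps `V(K)` to itself and fixes every vertex of `X ∪ Y`. -/
def IsSymmetricKOperation (G K : Graph α β) (x y : α) : Prop :=
  ∃ f : α → α,
    (G.deleteEdges (G.edgesBetween {x} (G.privateNbrs K x y) ∪
      G.edgesBetween {y} (G.privateNbrs K y x))).IsAutomorphism f ∧
    f x = y ∧ f y = x ∧ (∀ z ∈ V(K), f z ∈ V(K)) ∧
    ∀ v ∈ G.privateNbrs K x y ∪ G.privateNbrs K y x, f v = v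

end KOperation

end Graph

/-! Up to sign and an index shift, `c_s` is a coefficient of `det (X + L)`, so the aim is that `det
(X + L(G)) - det (X + L(G'))` has nonnegative coefficients. `G` is a σ-invariant core with a star at
`x` (edges to `X`) and a star at `y` (edges to `Y`); in `G'` both stars sit at `y`. Sharing each
star equally between `x` and `y` gives a σ-invariant Laplacian `L₀`. Relative to `L₀`, both
Laplacians are rank-two perturbations `d cᵀ + c dᵀ`, where `d = (e_x - e_y)/2` averages to zero on
σ-orbits and `c` is `f - g` or `-(f + g)`, with `f`, `g` constant on σ-orbits.

Let `E` be the averaging over orbits and `S = r + L₀`, which commutes with `E`. Each determinant is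
`det S * (1 - (c·S⁻¹c)(d·S⁻¹d))`, so the difference is `4 det S (d·S⁻¹d)(f·S⁻¹g)`. As `det S` splits
along kernel and range of `E`, this is 4 times a factor on the kernel times a factor on the range
(`Matrix.det_sub_det_eq_detIncrement_mul`).

Each factor is a polynomial in `r` with nonnegative coefficients. Replacing `r` by independent
parameters makes it multi-affine, so nonnegativity at positive parameters suffices
(`Polynomial.coeff_nonneg_of_multiaffine`). On the kernel this is positive semidefiniteness; on the
range it is the maximum principle for the potential with source vector `g`. -/

section DeterminantInequality

open Matrix Polynomial

/-! ### Determinants under perturbations of rank one and two -/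

section Determinants

variable {n R : Type*} [Fintype n] [DecidableEq n] [CommRing R]

/-- A rank-one perturbation changes the determinant by an affine function of its scale. -/
theorem Matrix.exists_det_add_smul_vecMulVec (A : Matrix n n R) (u v : n → R) :
    ∃ δ : R, ∀ τ : R, (A + τ • vecMulVec u v).det = A.det + τ * δ := by
  -- `A + τ u vᵀ` is the Schur complement of the corner 1 in a bordered matrix whose last row is
  -- affine in `τ`; no inverse of `A` is needed.
  refine ⟨(fromBlocks A (replicateCol Unit (-u)) (replicateRow Unit v) 0).det, fun τ => ?_⟩
  have h1 : (A + τ • vecMulVec u v).det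
      = (fromBlocks A (replicateCol Unit (-u)) (replicateRow Unit (τ • v)) 1).det := by
    rw [det_fromBlocks_one₂₂]
    congr 1
    ext i j
    simp [vecMulVec_apply, Matrix.mul_apply]
  have h2 : (fromBlocks A (replicateCol Unit (-u)) (replicateRow Unit (τ • v)) 1)
      = (fromBlocks A (replicateCol Unit (-u)) (0 : Matrix Unit n R) 1).updateRow (Sum.inr ())
        (Sum.elim (0 : n → R) (1 : Unit → R) + τ • Sum.elim v (0 : Unit → R)) := by
    ext (i | i) (j | j) <;> simp [updateRow_apply]
  have h3 : (fromBlocks A (replicateCol Unit (-u)) (0 : Matrix Unit n R) 1).updateRow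
      (Sum.inr ()) (Sum.elim (0 : n → R) (1 : Unit → R)) = fromBlocks A (replicateCol Unit (-u)) 0 1 := by
    ext (i | i) (j | j) <;> simp [updateRow_apply]
  have h4 : (fromBlocks A (replicateCol Unit (-u)) (0 : Matrix Unit n R) 1).updateRow
      (Sum.inr ()) (Sum.elim v (0 : Unit → R))
      = fromBlocks A (replicateCol Unit (-u)) (replicateRow Unit v) 0 := by
    ext (i | i) (j | j) <;> simp [updateRow_apply]
  rw [h1, h2, det_updateRow_add, det_updateRow_smul, h3, h4, det_fromBlocks_zero₂₁]
  simp

theorem Matrix.det_add_vecMulVec_of_mulVec_eq {A : Matrix n n R} {g φ : n → R} (f : n → R)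
    (h : A *ᵥ φ = g) : (A + vecMulVec g f).det = A.det * (1 + f ⬝ᵥ φ) := by
  have : A + vecMulVec g f = A * (1 + replicateCol Unit φ * replicateRow Unit f) := by
    rw [← h, mul_add, mul_one, ← Matrix.mul_assoc, ← replicateCol_mulVec, vecMulVec_eq Unit]
  rw [this, det_mul, det_one_add_replicateCol_mul_replicateRow]

/-- Factoring out `S` leaves a rank-two perturbation of the identity, which Sylvester's identity
turns into a 2×2 determinant; the orthogonality hypotheses make its diagonal entries 1. -/
theorem Matrix.det_add_vecMulVec_add_vecMulVec {S : Matrix n n R} {c d z w : n → R}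
    (hz : S *ᵥ z = d) (hw : S *ᵥ w = c) (hdw : d ⬝ᵥ w = 0) (hcz : c ⬝ᵥ z = 0) :
    (S + (vecMulVec d c + vecMulVec c d)).det = S.det * (1 - (c ⬝ᵥ w) * (d ⬝ᵥ z)) := by
  have h : S + (vecMulVec d c + vecMulVec c d)
      = S * (1 + (of ![z, w])ᵀ * of ![c, d]) := by
    rw [mul_add, mul_one, ← Matrix.mul_assoc]
    congr 1
    have : S * (of ![z, w])ᵀ = (of ![d, c])ᵀ := by
      ext i j
      fin_cases j
      · simpa [Matrix.mul_apply, mulVec, dotProduct] using congrFun hz i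
      · simpa [Matrix.mul_apply, mulVec, dotProduct] using congrFun hw i
    rw [this]
    ext i j
    simp [Matrix.mul_apply, vecMulVec_apply]
  have h2 : of ![c, d] * (of ![z, w])ᵀ = !![c ⬝ᵥ z, c ⬝ᵥ w; d ⬝ᵥ z, d ⬝ᵥ w] := by
    ext i j
    fin_cases i <;> fin_cases j <;> simp [Matrix.mul_apply, dotProduct]
  rw [h, det_mul, det_one_add_mul_comm, h2, hdw, hcz, one_fin_two, det_fin_two]
  simp

end Determinants

/-! ### Nonnegative coefficients from multi-affine dependence -/

section Coefficients

variable {n ι : Type*} [Fintype n] [DecidableEq n] [Fintype ι]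

/-- A multi-affine expression that is nonnegative for positive values of the parameters has
nonnegative coefficients. -/
theorem Polynomial.coeff_nonneg_of_multiaffine [DecidableEq ι] (F : (ι → ℝ[X]) → ℝ[X])
    (hF : ∀ t j, ∃ P Q : ℝ[X], ∀ c, F (Function.update t j c) = P + c * Q)
    (hpos : ∀ t : ι → ℝ, (∀ i, 0 < t i) → ∀ k, 0 ≤ (F fun i => C (t i)).coeff k) (k : ℕ) :
    0 ≤ (F fun _ => X).coeff k := by
  -- The constants are replaced by `X` one at a time. If `P + c Q` has nonnegative coefficients for
  -- all real `c > 0`, so do `P` and `Q`, hence also `P + X Q`.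
  have key : ∀ s : Finset ι, ∀ t : ι → ℝ, (∀ i, 0 < t i) → ∀ k,
      0 ≤ (F fun i => if i ∈ s then X else C (t i)).coeff k := by
    intro s
    induction s using Finset.induction_on with
    | empty => simpa using hpos
    | insert j s hj ih =>
      intro t ht
      obtain ⟨P, Q, hPQ⟩ := hF (fun i => if i ∈ s then X else C (t i)) j
      have hc : ∀ c : ℝ, 0 < c → ∀ k, 0 ≤ P.coeff k + c * Q.coeff k := by
        intro c hc k
        have h := ih (Function.update t j c) (by
          intro i
          rcases eq_or_ne i j with rfl | hi
          · simpa using hc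
          · simpa [hi] using ht i) k
        have h2 : (fun i => if i ∈ s then X else C (Function.update t j c i))
            = Function.update (fun i => if i ∈ s then X else C (t i)) j (C c) := by
          ext1 i
          rcases eq_or_ne i j with rfl | hi
          · simp [hj]
          · simp [hi]
        rw [h2, hPQ, coeff_add, coeff_C_mul] at h
        exact h
      have hP : ∀ k, 0 ≤ P.coeff k := by
        intro k
        by_contra! hlt
        -- So small that `c * Q.coeff k` offsets at most half of the negative `P.coeff k`.
        have h := hc (-P.coeff k / (2 * (|Q.coeff k| + 1))) (by
          have := abs_nonneg (Q.coeff k)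
          exact div_pos (by linarith) (by linarith)) k
        have h1 : -P.coeff k / (2 * (|Q.coeff k| + 1)) * Q.coeff k ≤ -P.coeff k / 2 := by
          have h3 := le_abs_self (Q.coeff k)
          have h4 := abs_nonneg (Q.coeff k)
          rw [div_mul_eq_mul_div, div_le_div_iff₀ (by linarith) (by norm_num)]
          nlinarith
        linarith
      have hQ : ∀ k, 0 ≤ Q.coeff k := by
        intro k
        by_contra! hlt
        -- So large that the sum becomes exactly -1.
        have h := hc ((P.coeff k + 1) / (-Q.coeff k)) (div_pos (by linarith [hP k]) (by linarith)) k
        have h1 : (P.coeff k + 1) / (-Q.coeff k) * Q.coeff k = -(P.coeff k + 1) := by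
          rw [div_neg, neg_mul, div_mul_cancel₀ _ hlt.ne]
        linarith
      intro k
      have h2 : (fun i => if i ∈ insert j s then X else C (t i))
          = Function.update (fun i => if i ∈ s then X else C (t i)) j X := by
        ext1 i
        rcases eq_or_ne i j with rfl | hi
        · simp
        · simp [hi]
      rw [h2, hPQ, coeff_add]
      rcases k with _ | k
      · simpa using hP 0
      · rw [coeff_X_mul]
        exact add_nonneg (hP _) (hQ _)
  simpa using key Finset.univ (fun _ => 1) (fun _ => one_pos) k

/-- The difference `det (A + g fᵀ) - det A`, i.e. `fᵀ (adj A) g`. -/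
def Matrix.detIncrement {R : Type*} [CommRing R] (A : Matrix n n R) (g f : n → R) : R :=
  (A + vecMulVec g f).det - A.det

theorem Matrix.detIncrement_of_mulVec_eq {R : Type*} [CommRing R] {A : Matrix n n R} {g φ : n → R}
    (f : n → R) (h : A *ᵥ φ = g) : A.detIncrement g f = A.det * (f ⬝ᵥ φ) := by
  rw [detIncrement, det_add_vecMulVec_of_mulVec_eq f h]
  ring

theorem RingHom.map_detIncrement {R S : Type*} [CommRing R] [CommRing S] (h : R →+* S)
    (A : Matrix n n R) (g f : n → R) :
    h (A.detIncrement g f) = (A.map h).detIncrement (h ∘ g) (h ∘ f) := by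
  rw [Matrix.detIncrement, map_sub, RingHom.map_det, RingHom.map_det, Matrix.detIncrement]
  congr 2
  ext i j
  simp [vecMulVec_apply]

/-- The matrix `B + ∑ i, t i • u i (v i)ᵀ` with entries in `ℝ[X]`. -/
noncomputable def Matrix.polyPencil (B : Matrix n n ℝ) (u v : ι → n → ℝ) (t : ι → ℝ[X]) :
    Matrix n n ℝ[X] :=
  B.map C + ∑ i, t i • vecMulVec (C ∘ u i) (C ∘ v i)

omit [Fintype n] [DecidableEq n] in
theorem Matrix.polyPencil_update [DecidableEq ι] (B : Matrix n n ℝ) (u v : ι → n → ℝ)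
    (t : ι → ℝ[X]) (j : ι) (c : ℝ[X]) :
    polyPencil B u v (Function.update t j c)
      = polyPencil B u v (Function.update t j 0) + c • vecMulVec (C ∘ u j) (C ∘ v j) := by
  rw [polyPencil, polyPencil, add_assoc]
  congr 1
  rw [Fintype.sum_eq_add_sum_compl j, Fintype.sum_eq_add_sum_compl j]
  simp only [Function.update_self, zero_smul, zero_add]
  rw [add_comm]
  congr 1
  refine Finset.sum_congr rfl fun i hi => ?_
  have : i ≠ j := by simpa using hi
  simp [this]

omit [Fintype n] [DecidableEq n] in
theorem Matrix.polyPencil_map (B : Matrix n n ℝ) (u v : ι → n → ℝ) (t : ι → ℝ[X]) (r : ℝ) :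
    (polyPencil B u v t).map (evalRingHom r)
      = B + ∑ i, (t i).eval r • vecMulVec (u i) (v i) := by
  ext i j
  simp [polyPencil, Matrix.sum_apply, eval_finsetSum, vecMulVec_apply]

omit [Fintype n] [DecidableEq n] in
theorem Matrix.polyPencil_C (B : Matrix n n ℝ) (u v : ι → n → ℝ) (t : ι → ℝ) :
    polyPencil B u v (fun i => C (t i))
      = (B + ∑ i, t i • vecMulVec (u i) (v i)).map C := by
  ext1 i j
  simp [polyPencil, Matrix.sum_apply, vecMulVec_apply]

/-- Every parameter multiplies a rank-one matrix, so both determinants in the increment are affine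
in each parameter separately. -/
theorem Matrix.coeff_detIncrement_polyPencil_nonneg (B : Matrix n n ℝ) (u v : ι → n → ℝ)
    (g f : n → ℝ)
    (h : ∀ t : ι → ℝ, (∀ i, 0 < t i) →
      0 ≤ (B + ∑ i, t i • vecMulVec (u i) (v i)).detIncrement g f) (k : ℕ) :
    0 ≤ ((polyPencil B u v fun _ => X).detIncrement (C ∘ g) (C ∘ f)).coeff k := by
  classical
  refine coeff_nonneg_of_multiaffine
    (fun t => (polyPencil B u v t).detIncrement (C ∘ g) (C ∘ f)) ?_ ?_ k
  · intro t j
    obtain ⟨δ, hδ⟩ := exists_det_add_smul_vecMulVec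
      (polyPencil B u v (Function.update t j 0)) (C ∘ u j) (C ∘ v j)
    obtain ⟨ε, hε⟩ := exists_det_add_smul_vecMulVec
      (polyPencil B u v (Function.update t j 0) + vecMulVec (C ∘ g) (C ∘ f)) (C ∘ u j) (C ∘ v j)
    refine ⟨(polyPencil B u v (Function.update t j 0)).detIncrement (C ∘ g) (C ∘ f), ε - δ,
      fun c => ?_⟩
    simp only [detIncrement]
    rw [polyPencil_update, add_right_comm, hδ, hε]
    ring
  · intro t ht k
    simp only [polyPencil_C]
    have := RingHom.map_detIncrement (C : ℝ →+* ℝ[X])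
      (B + ∑ i, t i • vecMulVec (u i) (v i)) g f
    rw [← this, coeff_C]
    split_ifs
    · exact h t ht
    · exact le_rfl

end Coefficients

/-! ### Splitting along a commuting symmetric projection -/

section Projection

variable {n : Type*} [Fintype n] [DecidableEq n]

theorem Matrix.PosSemidef.detIncrement_self_nonneg {S : Matrix n n ℝ} (hS : S.PosSemidef)
    (d : n → ℝ) : 0 ≤ S.detIncrement d d := by
  by_cases h : S.det = 0
  · rw [detIncrement, h, sub_zero]
    refine (hS.add ?_).det_nonneg
    simpa using posSemidef_vecMulVec_self_star d
  · have hu : IsUnit S.det := isUnit_iff_ne_zero.2 h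
    have hφ : S *ᵥ (S⁻¹ *ᵥ d) = d := by
      rw [mulVec_mulVec, mul_nonsing_inv _ hu, one_mulVec]
    rw [detIncrement_of_mulVec_eq d hφ]
    refine mul_nonneg hS.det_nonneg ?_
    simpa using hS.inv.dotProduct_mulVec_nonneg d

variable {E S : Matrix n n ℝ}

/-- The two factors are `S` restricted to the range and to the kernel of `E`, each extended by the
identity; their product is `S`. -/
theorem Matrix.det_split_of_commute (hE : E * E = E) (hS : E * S = S * E) :
    (S * E + (1 - E)).det * (S * (1 - E) + E).det = S.det := by
  rw [← det_mul]
  congr 1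
  have h1 : S * E * (S * (1 - E)) = 0 := by
    rw [← hS, mul_assoc, ← mul_assoc S S, ← mul_assoc E, ← mul_assoc E S, hS, mul_assoc S E, hS,
      mul_assoc, mul_assoc, mul_sub, mul_one, hE, sub_self, mul_zero, mul_zero]
  have h2 : (1 - E) * (S * (1 - E)) = S * (1 - E) := by
    rw [sub_mul, one_mul, ← mul_assoc, hS, mul_assoc, mul_sub E, mul_one, hE, sub_self, mul_zero,
      sub_zero]
  rw [add_mul, mul_add, mul_add, h1, h2, mul_assoc, hE, sub_mul 1 E E, one_mul, hE, sub_self,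
    mul_sub, mul_one]
  abel

theorem Matrix.mulVec_eq_of_commute (hS : E * S = S * E) (hdet : S.det ≠ 0) {φ g : n → ℝ}
    (hφ : S *ᵥ φ = g) (c : ℝ) (hg : E *ᵥ g = c • g) : E *ᵥ φ = c • φ := by
  refine mulVec_injective_of_isUnit ((isUnit_iff_isUnit_det S).2 (isUnit_iff_ne_zero.2 hdet)) ?_
  rw [mulVec_mulVec, ← hS, ← mulVec_mulVec, hφ, hg, mulVec_smul, hφ]

omit [DecidableEq n] in
theorem Matrix.dotProduct_mulVec_comm_of_isSymm (hS : S.IsSymm) (φ ψ : n → ℝ) :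
    φ ⬝ᵥ (S *ᵥ ψ) = ψ ⬝ᵥ (S *ᵥ φ) := by
  rw [dotProduct_mulVec, ← mulVec_transpose, hS.eq, dotProduct_comm]

/-- The values of `c·S⁻¹c` at `c = f - g` and `c = -(f + g)` differ only in the cross term, by `4
f·S⁻¹g`. The remaining `det S` splits, the kernel factor taking up `d·S⁻¹d` and the range factor
`f·S⁻¹g`. -/
theorem Matrix.det_sub_det_eq_detIncrement_mul (hE : E * E = E) (hEs : E.IsSymm)
    (hS : E * S = S * E) (hSs : S.IsSymm) (hdet : S.det ≠ 0) {d f g : n → ℝ}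
    (hd : E *ᵥ d = 0) (hf : E *ᵥ f = f) (hg : E *ᵥ g = g) :
    (S + (vecMulVec d (f - g) + vecMulVec (f - g) d)).det
      - (S + (vecMulVec d (-(f + g)) + vecMulVec (-(f + g)) d)).det
      = 4 * ((S * (1 - E) + E).detIncrement d d * (S * E + (1 - E)).detIncrement g f) := by
  have hu : IsUnit S.det := isUnit_iff_ne_zero.2 hdet
  have hex : ∀ g : n → ℝ, ∃ φ, S *ᵥ φ = g := fun g =>
    ⟨S⁻¹ *ᵥ g, by rw [mulVec_mulVec, mul_nonsing_inv _ hu, one_mulVec]⟩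
  obtain ⟨z, hz⟩ := hex d
  obtain ⟨φ, hφ⟩ := hex f
  obtain ⟨ψ, hψ⟩ := hex g
  have hEz : E *ᵥ z = 0 := by simpa using mulVec_eq_of_commute hS hdet hz 0 (by simpa using hd)
  have hEφ : E *ᵥ φ = φ := by simpa using mulVec_eq_of_commute hS hdet hφ 1 (by simpa using hf)
  have hEψ : E *ᵥ ψ = ψ := by simpa using mulVec_eq_of_commute hS hdet hψ 1 (by simpa using hg)
  have horth : ∀ a b : n → ℝ, E *ᵥ a = 0 → E *ᵥ b = b → a ⬝ᵥ b = 0 := by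
    intro a b ha hb
    rw [← hb, dotProduct_mulVec_comm_of_isSymm hEs, ha, dotProduct_zero]
  have hfg : f ⬝ᵥ ψ = g ⬝ᵥ φ := by
    rw [← hφ, ← hψ, dotProduct_comm, dotProduct_mulVec_comm_of_isSymm hSs, dotProduct_comm]
  have h1 : (S * (1 - E) + E) *ᵥ z = d := by
    rw [add_mulVec, ← mulVec_mulVec, sub_mulVec, one_mulVec, hEz, sub_zero, hz, add_zero]
  have h2 : (S * E + (1 - E)) *ᵥ ψ = g := by
    rw [add_mulVec, ← mulVec_mulVec, sub_mulVec, one_mulVec, hEψ, sub_self, hψ, add_zero]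
  rw [detIncrement_of_mulVec_eq _ h1, detIncrement_of_mulVec_eq _ h2,
    det_add_vecMulVec_add_vecMulVec (c := f - g) hz
      (w := φ - ψ) (by rw [mulVec_sub, hφ, hψ])
      (horth _ _ hd (by rw [mulVec_sub, hEφ, hEψ]))
      (by rw [dotProduct_comm]; exact horth _ _ hEz (by rw [mulVec_sub, hf, hg])),
    det_add_vecMulVec_add_vecMulVec (c := -(f + g)) hz
      (w := -(φ + ψ)) (by rw [mulVec_neg, mulVec_add, hφ, hψ])
      (horth _ _ hd (by rw [mulVec_neg, mulVec_add, hEφ, hEψ]))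
      (by rw [dotProduct_comm]; exact horth _ _ hEz (by rw [mulVec_neg, mulVec_add, hf, hg])),
    ← det_split_of_commute hE hS]
  simp only [dotProduct_sub, sub_dotProduct, dotProduct_neg, neg_dotProduct, dotProduct_add,
    add_dotProduct]
  rw [hfg]
  ring

end Projection

/-! ### Weighted Laplacians and the maximum principle -/

section WeightedLaplacian

variable {n : Type*} [Fintype n] [DecidableEq n]

/-- The Laplacian matrix of the weighted graph with edge weights `r`. -/
def Matrix.weightedLaplacian (r : n → n → ℝ) : Matrix n n ℝ :=
  diagonal (fun v => ∑ w, r v w) - of r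

theorem Matrix.weightedLaplacian_mulVec (r : n → n → ℝ) (φ : n → ℝ) (v : n) :
    (weightedLaplacian r *ᵥ φ) v = ∑ w, r v w * (φ v - φ w) := by
  simp [weightedLaplacian, sub_mulVec, mulVec_diagonal, mul_sub, Finset.sum_mul]
  rfl

theorem Matrix.weightedLaplacian_add (r r' : n → n → ℝ) :
    weightedLaplacian (r + r') = weightedLaplacian r + weightedLaplacian r' := by
  ext i j
  by_cases h : i = j <;>
    simp [weightedLaplacian, h, Finset.sum_add_distrib] <;> ring

theorem Matrix.weightedLaplacian_smul (c : ℝ) (r : n → n → ℝ) :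
    weightedLaplacian (c • r) = c • weightedLaplacian r := by
  ext i j
  by_cases h : i = j <;>
    simp [weightedLaplacian, h, Finset.mul_sum, mul_sub]

theorem Matrix.weightedLaplacian_isSymm {r : n → n → ℝ} (hr : ∀ v w, r v w = r w v) :
    (weightedLaplacian r).IsSymm := by
  refine IsSymm.sub (isSymm_diagonal _) ?_
  ext i j
  simp [hr i j]

theorem Matrix.sum_weightedLaplacian_mulVec {r : n → n → ℝ} (hr : ∀ v w, r v w = r w v)
    (φ : n → ℝ) : ∑ v, (weightedLaplacian r *ᵥ φ) v = 0 := by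
  simp only [weightedLaplacian_mulVec]
  have h : ∑ v, ∑ w, r v w * (φ v - φ w) = - ∑ v, ∑ w, r v w * (φ v - φ w) := by
    conv_lhs => rw [Finset.sum_comm]
    rw [← Finset.sum_neg_distrib]
    refine Finset.sum_congr rfl fun v _ => ?_
    rw [← Finset.sum_neg_distrib]
    refine Finset.sum_congr rfl fun w _ => ?_
    rw [hr w v]
    ring
  linarith

theorem Matrix.weightedLaplacian_posSemidef {r : n → n → ℝ} (hr : ∀ v w, r v w = r w v)
    (h0 : ∀ v w, 0 ≤ r v w) : (weightedLaplacian r).PosSemidef := by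
  refine PosSemidef.of_dotProduct_mulVec_nonneg ?_ fun φ => ?_
  · rw [IsHermitian, conjTranspose_eq_transpose_of_trivial]
    exact weightedLaplacian_isSymm hr
  · have h1 : φ ⬝ᵥ (weightedLaplacian r *ᵥ φ) = ∑ v, ∑ w, r v w * (φ v * (φ v - φ w)) := by
      simp only [dotProduct, weightedLaplacian_mulVec, Finset.mul_sum]
      refine Finset.sum_congr rfl fun v _ => Finset.sum_congr rfl fun w _ => ?_
      ring
    have h2 : φ ⬝ᵥ (weightedLaplacian r *ᵥ φ) = ∑ v, ∑ w, r v w * (φ w * (φ w - φ v)) := by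
      rw [h1, Finset.sum_comm]
      refine Finset.sum_congr rfl fun v _ => Finset.sum_congr rfl fun w _ => ?_
      rw [hr w v]
    have h3 : 0 ≤ φ ⬝ᵥ (weightedLaplacian r *ᵥ φ) + φ ⬝ᵥ (weightedLaplacian r *ᵥ φ) := by
      nth_rw 1 [h1]
      rw [h2, ← Finset.sum_add_distrib]
      refine Finset.sum_nonneg fun v _ => ?_
      rw [← Finset.sum_add_distrib]
      refine Finset.sum_nonneg fun w _ => ?_
      have := mul_nonneg (h0 v w) (sq_nonneg (φ v - φ w))
      linarith
    simpa using by linarith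

/-- **Maximum principle**: a potential generated by sources at `x`, `y` and sinks elsewhere is
maximal at `x`, `y` when it takes the same value there. -/
theorem Matrix.le_of_diagonal_add_weightedLaplacian_mulVec_eq {r : n → n → ℝ}
    (hr : ∀ v w, r v w = r w v) (h0 : ∀ v w, 0 ≤ r v w) {δ φ g : n → ℝ} (hδ : ∀ v, 0 < δ v)
    (hφ : (diagonal δ + weightedLaplacian r) *ᵥ φ = g) (hg : ∑ v, g v = 0) {x y : n}
    (hxy : φ x = φ y) (hgn : ∀ v, v ≠ x → v ≠ y → g v ≤ 0) (v : n) : φ v ≤ φ x := by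
  obtain ⟨m, -, hm⟩ := Finset.exists_max_image Finset.univ φ ⟨x, Finset.mem_univ x⟩
  have hrow : ∀ v, δ v * φ v + ∑ w, r v w * (φ v - φ w) = g v := fun v => by
    rw [← weightedLaplacian_mulVec, ← hφ, add_mulVec, Pi.add_apply, mulVec_diagonal]
  have hsum : ∑ v, δ v * φ v = 0 := by
    have := Finset.sum_congr rfl fun v (_ : v ∈ Finset.univ) => hrow v
    rw [Finset.sum_add_distrib, hg] at this
    simp only [← weightedLaplacian_mulVec] at this
    rwa [sum_weightedLaplacian_mulVec hr, add_zero] at this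
  -- The `δ`-weighted sum of `φ` is zero, so a nonpositive `φ` vanishes. Otherwise the maximum is
  -- positive, and at a maximizer other than `x`, `y` the row equation would have positive left side
  -- and nonpositive right side.
  rcases le_or_gt (φ m) 0 with h | h
  · have hle : ∀ v, φ v ≤ 0 := fun v => (hm v (Finset.mem_univ v)).trans h
    have hz : ∀ v, φ v = 0 := fun v => by
      have := (Finset.sum_eq_zero_iff_of_nonpos fun v _ =>
        mul_nonpos_of_nonneg_of_nonpos (hδ v).le (hle v)).1 hsum v (Finset.mem_univ v)
      exact (mul_eq_zero.1 this).resolve_left (hδ v).ne'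
    rw [hz, hz]
  · have hmx : φ m = φ x := by
      by_contra hne
      have h1 := hgn m (fun h => hne (by rw [h])) (fun h => hne (by rw [h, hxy]))
      have h2 : 0 ≤ ∑ w, r m w * (φ m - φ w) := Finset.sum_nonneg fun w _ =>
        mul_nonneg (h0 m w) (sub_nonneg.2 (hm w (Finset.mem_univ w)))
      have h3 := mul_pos (hδ m) h
      linarith [hrow m]
    rw [← hmx]
    exact hm v (Finset.mem_univ v)

end WeightedLaplacian

/-! ### Averaging over the fibers of a map -/

section FiberAverage

variable {n O : Type*} [Fintype n] [DecidableEq n] [DecidableEq O] (q : n → O)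

/-- The orthogonal projection onto the vectors that are constant on the fibers of `q`. -/
noncomputable def Matrix.fiberAverage : Matrix n n ℝ :=
  of fun v w => if q v = q w then ((Finset.univ.filter fun z => q z = q w).card : ℝ)⁻¹ else 0

omit [DecidableEq n] in
theorem Matrix.fiberAverage_isSymm : (fiberAverage q).IsSymm := by
  ext v w
  by_cases h : q v = q w
  · simp [fiberAverage, h]
  · simp [fiberAverage, h, Ne.symm h]

omit [DecidableEq n] in
theorem Matrix.fiberAverage_mulVec (φ : n → ℝ) (v : n) :
    (fiberAverage q *ᵥ φ) v
      = ((Finset.univ.filter fun z => q z = q v).card : ℝ)⁻¹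
        * ∑ w ∈ Finset.univ.filter fun z => q z = q v, φ w := by
  simp only [mulVec, dotProduct, fiberAverage, of_apply, ite_mul, zero_mul]
  rw [Finset.mul_sum, Finset.sum_filter]
  refine Finset.sum_congr rfl fun w _ => ?_
  by_cases h : q w = q v
  · simp [h]
  · simp [h, Ne.symm h]

variable {q}

omit [DecidableEq n] in
theorem Matrix.fiberAverage_mulVec_of_const {φ : n → ℝ} (h : ∀ v w, q v = q w → φ v = φ w) :
    fiberAverage q *ᵥ φ = φ := by
  ext v
  rw [fiberAverage_mulVec]
  rw [Finset.sum_congr rfl fun w hw => h w v (Finset.mem_filter.1 hw).2, Finset.sum_const,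
    nsmul_eq_mul, ← mul_assoc, inv_mul_cancel₀, one_mul]
  exact Nat.cast_ne_zero.2 (Finset.card_ne_zero.2 ⟨v, by simp⟩)

omit [DecidableEq n] in
theorem Matrix.fiberAverage_mulVec_const (φ : n → ℝ) {v w : n} (h : q v = q w) :
    (fiberAverage q *ᵥ φ) v = (fiberAverage q *ᵥ φ) w := by
  rw [fiberAverage_mulVec, fiberAverage_mulVec, h]

theorem Matrix.fiberAverage_mul_of_forall {A : Matrix n n ℝ}
    (h : ∀ φ : n → ℝ, ∀ v w, q v = q w → (A *ᵥ φ) v = (A *ᵥ φ) w) :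
    fiberAverage q * A = A := by
  refine ext_of_mulVec_single fun i => ?_
  rw [← mulVec_mulVec]
  exact fiberAverage_mulVec_of_const (h _)

theorem Matrix.fiberAverage_mul_self : fiberAverage q * fiberAverage q = fiberAverage q :=
  fiberAverage_mul_of_forall fun φ _ _ h => fiberAverage_mulVec_const φ h

/-- Invariance of the range gives `E S E = S E`; transposing with `S` and `E` symmetric gives `E S E
= E S`. -/
theorem Matrix.fiberAverage_commute {S : Matrix n n ℝ} (hS : S.IsSymm)
    (h : ∀ φ : n → ℝ, (∀ v w, q v = q w → φ v = φ w) →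
      ∀ v w, q v = q w → (S *ᵥ φ) v = (S *ᵥ φ) w) :
    fiberAverage q * S = S * fiberAverage q := by
  have h1 : fiberAverage q * (S * fiberAverage q) = S * fiberAverage q :=
    fiberAverage_mul_of_forall fun φ => by
      rw [← mulVec_mulVec]
      exact h _ fun v w => fiberAverage_mulVec_const φ
  have h2 := congrArg transpose h1
  simp only [transpose_mul, hS.eq, (fiberAverage_isSymm q).eq] at h2
  rw [← h2, mul_assoc, h1]

/-- This writes the range part of a fiber-constant diagonal as a pencil with one rank-one term per
fiber. -/
theorem Matrix.sum_smul_fiber [Fintype O] (t : O → ℝ) :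
    ∑ o, t o • vecMulVec (fun v => if q v = o then (1 : ℝ) else 0)
        (fun w => if q w = o then ((Finset.univ.filter fun z => q z = o).card : ℝ)⁻¹ else 0)
      = diagonal (fun v => t (q v)) * fiberAverage q := by
  ext v w
  simp only [Matrix.sum_apply, smul_apply, vecMulVec_apply, smul_eq_mul, ite_mul, one_mul,
    zero_mul, diagonal_mul, fiberAverage, of_apply]
  rw [Finset.sum_eq_single (q v)]
  · by_cases h : q v = q w
    · simp [h]
    · simp [h, Ne.symm h]
  · intro o _ ho
    simp [Ne.symm ho]
  · simp

theorem Matrix.sum_smul_col (F : Matrix n n ℝ) (t : n → ℝ) :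
    ∑ i, t i • vecMulVec (F.col i) (F.col i) = F * diagonal t * Fᵀ := by
  ext v w
  simp only [Matrix.sum_apply, smul_apply, vecMulVec_apply, smul_eq_mul, mul_apply (M := F * _),
    mul_diagonal, col_apply, transpose_apply]
  exact Finset.sum_congr rfl fun i _ => by ring

end FiberAverage

/-! ### Coefficientwise comparison of the two determinants -/

section Comparison

variable {n O : Type*} [Fintype n] [DecidableEq n] [Fintype O] [DecidableEq O] {q : n → O}

/-- The difference is `4 F G`, with `F` from the kernel of `E` and `G` from its range. `F` has one
parameter per vertex, as it needs only semidefiniteness; `G` has one per fiber, so that the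
perturbed matrix still commutes with `E` and the potential takes equal values at `x` and `y`. -/
theorem Polynomial.coeff_det_sub_nonneg {r : n → n → ℝ}
    (hr : ∀ v w, r v w = r w v) (h0 : ∀ v w, 0 ≤ r v w)
    (hq : ∀ φ : n → ℝ, (∀ v w, q v = q w → φ v = φ w) →
      ∀ v w, q v = q w → (weightedLaplacian r *ᵥ φ) v = (weightedLaplacian r *ᵥ φ) w)
    {d f g : n → ℝ} {x y : n} (hxy : q x = q y) (hd : fiberAverage q *ᵥ d = 0)
    (hf : ∀ v w, q v = q w → f v = f w) (hg : ∀ v w, q v = q w → g v = g w)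
    (hfs : ∑ v, f v = 0) (hgs : ∑ v, g v = 0) (hfn : ∀ v, v ≠ x → v ≠ y → f v ≤ 0)
    (hgn : ∀ v, v ≠ x → v ≠ y → g v ≤ 0) (k : ℕ) :
    ((X : ℝ[X]) • (1 : Matrix n n ℝ[X]) + (weightedLaplacian r
      + (vecMulVec d (-(f + g)) + vecMulVec (-(f + g)) d)).map C).det.coeff k
    ≤ ((X : ℝ[X]) • (1 : Matrix n n ℝ[X]) + (weightedLaplacian r
      + (vecMulVec d (f - g) + vecMulVec (f - g) d)).map C).det.coeff k := by
  set L := weightedLaplacian r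
  set E := fiberAverage q
  have hLs : L.IsSymm := weightedLaplacian_isSymm hr
  have hLp : L.PosSemidef := weightedLaplacian_posSemidef hr h0
  have hEE : E * E = E := fiberAverage_mul_self
  have hEs : E.IsSymm := fiberAverage_isSymm q
  have hFs : (1 - E)ᵀ = 1 - E := by rw [transpose_sub, transpose_one, hEs.eq]
  have hFF : (1 - E) * (1 - E) = 1 - E := by
    rw [sub_mul, one_mul, mul_sub, mul_one, hEE, sub_self, sub_zero]
  have hcomm : ∀ δ : n → ℝ, (∀ v w, q v = q w → δ v = δ w) →
      E * (diagonal δ + L) = (diagonal δ + L) * E := by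
    intro δ hδ
    refine fiberAverage_commute (IsSymm.add (isSymm_diagonal _) hLs) fun φ hφ v w hvw => ?_
    rw [add_mulVec, Pi.add_apply, Pi.add_apply, mulVec_diagonal, mulVec_diagonal, hδ v w hvw,
      hφ v w hvw, hq φ hφ v w hvw]
  have hLE : E * L = L * E := fiberAverage_commute hLs hq
  have hEf : E *ᵥ f = f := fiberAverage_mulVec_of_const hf
  have hEg : E *ᵥ g = g := fiberAverage_mulVec_of_const hg
  have hpd : ∀ δ : n → ℝ, (∀ v, 0 < δ v) → (diagonal δ + L).PosDef := fun δ hδ =>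
    (PosDef.diagonal hδ).add_posSemidef hLp
  have hF : ∀ k, 0 ≤ ((polyPencil (L * (1 - E) + E) (1 - E).col (1 - E).col
      fun _ => X).detIncrement (C ∘ d) (C ∘ d)).coeff k := by
    refine coeff_detIncrement_polyPencil_nonneg _ _ _ _ _ fun t ht => ?_
    refine PosSemidef.detIncrement_self_nonneg ?_ d
    -- The pencil is the compression of `diagonal t + L` to the kernel of `E`, plus `E`; `diagonal
    -- t` need not commute with `E`.
    have : L * (1 - E) + E + ∑ i, t i • vecMulVec ((1 - E).col i) ((1 - E).col i)
        = (1 - E)ᴴ * (diagonal t + L) * (1 - E) + Eᴴ * E := by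
      have hLF : (1 - E) * L = L * (1 - E) := by
        rw [sub_mul, one_mul, mul_sub, mul_one, hLE]
      rw [sum_smul_col, conjTranspose_eq_transpose_of_trivial,
        conjTranspose_eq_transpose_of_trivial, hFs, hEs.eq, hEE, mul_add, add_mul, hLF,
        mul_assoc L, hFF]
      abel
    rw [this]
    exact ((hpd t ht).posSemidef.conjTranspose_mul_mul_same _).add
      (posSemidef_conjTranspose_mul_self _)
  have hG : ∀ k, 0 ≤ ((polyPencil (L * E + (1 - E))
      (fun (o : O) v => if q v = o then (1 : ℝ) else 0)
      (fun (o : O) w => if q w = o then ((Finset.univ.filter fun z => q z = o).card : ℝ)⁻¹ else 0)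
      fun _ => X).detIncrement (C ∘ g) (C ∘ f)).coeff k := by
    refine coeff_detIncrement_polyPencil_nonneg _ _ _ _ _ fun t ht => ?_
    have hδ : ∀ v, 0 < t (q v) := fun v => ht _
    set D := diagonal (fun v => t (q v)) + L
    have hD : D.PosDef := hpd _ hδ
    have hDE : E * D = D * E := hcomm _ fun v w h => by rw [h]
    have hu : IsUnit D.det := isUnit_iff_ne_zero.2 hD.det_pos.ne'
    have hS : L * E + (1 - E) + ∑ o, t o • vecMulVec (fun v => if q v = o then (1 : ℝ) else 0)
        (fun w => if q w = o then ((Finset.univ.filter fun z => q z = o).card : ℝ)⁻¹ else 0)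
        = D * E + (1 - E) := by
      rw [sum_smul_fiber, add_mul]
      abel
    have hSp : (D * E + (1 - E)).PosSemidef := by
      have : D * E + (1 - E) = Eᴴ * D * E + (1 - E)ᴴ * (1 - E) := by
        rw [conjTranspose_eq_transpose_of_trivial, conjTranspose_eq_transpose_of_trivial, hFs,
          hEs.eq, hFF, hDE, mul_assoc D, hEE]
      rw [this]
      exact (hD.posSemidef.conjTranspose_mul_mul_same _).add
        (posSemidef_conjTranspose_mul_self _)
    have hφ : D *ᵥ (D⁻¹ *ᵥ g) = g := by
      rw [mulVec_mulVec, mul_nonsing_inv _ hu, one_mulVec]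
    set φ := D⁻¹ *ᵥ g
    have hEφ : E *ᵥ φ = φ := by
      simpa using mulVec_eq_of_commute hDE hD.det_pos.ne' hφ 1 (by simpa using hEg)
    have hφxy : φ x = φ y := by
      rw [← hEφ]
      exact fiberAverage_mulVec_const φ hxy
    have hmax := le_of_diagonal_add_weightedLaplacian_mulVec_eq hr h0 hδ hφ hgs hφxy hgn
    have h2 : (D * E + (1 - E)) *ᵥ φ = g := by
      rw [add_mulVec, ← mulVec_mulVec, sub_mulVec, one_mulVec, hEφ, sub_self, hφ, add_zero]
    rw [hS, detIncrement_of_mulVec_eq _ h2]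
    refine mul_nonneg hSp.det_nonneg ?_
    -- As `f` has total 0, the maximum `φ x` can be subtracted; then both factors are nonpositive
    -- off `x` and `y`, and the terms at `x`, `y` vanish.
    have : f ⬝ᵥ φ = ∑ v, f v * (φ v - φ x) := by
      simp only [mul_sub, Finset.sum_sub_distrib, ← Finset.sum_mul, hfs, zero_mul, sub_zero]
      rfl
    rw [this]
    refine Finset.sum_nonneg fun v _ => ?_
    by_cases hvx : v = x
    · simp [hvx]
    by_cases hvy : v = y
    · simp [hvy, hφxy]
    exact mul_nonneg_of_nonpos_of_nonpos (hfn v hvx hvy) (sub_nonpos.2 (hmax v))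
  set F := (polyPencil (L * (1 - E) + E) (1 - E).col (1 - E).col
      fun _ => X).detIncrement (C ∘ d) (C ∘ d) with hFdef
  set G := (polyPencil (L * E + (1 - E))
      (fun (o : O) v => if q v = o then (1 : ℝ) else 0)
      (fun (o : O) w => if q w = o then ((Finset.univ.filter fun z => q z = o).card : ℝ)⁻¹ else 0)
      fun _ => X).detIncrement (C ∘ g) (C ∘ f) with hGdef
  have hC : ∀ (r : ℝ) (a : n → ℝ), evalRingHom r ∘ C ∘ a = a := fun r a => by ext; simp
  have hev : ∀ (A : Matrix n n ℝ) (r : ℝ),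
      (((X : ℝ[X]) • (1 : Matrix n n ℝ[X]) + A.map C).det).eval r = (r • 1 + A).det := by
    intro A r
    rw [← coe_evalRingHom, RingHom.map_det]
    congr 1
    ext i j
    by_cases h : i = j <;> simp [h]
  have hid : ((X : ℝ[X]) • (1 : Matrix n n ℝ[X]) + (L
      + (vecMulVec d (f - g) + vecMulVec (f - g) d)).map C).det
      = ((X : ℝ[X]) • (1 : Matrix n n ℝ[X]) + (L
      + (vecMulVec d (-(f + g)) + vecMulVec (-(f + g)) d)).map C).det + C 4 * (F * G) := by
    -- At every `r > 0` the matrix `r + L` is positive definite, hence invertible, as the pointwise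
    -- identity requires.
    refine Polynomial.eq_of_infinite_eval_eq _ _ ((Set.Ioi_infinite (0 : ℝ)).mono fun r hr => ?_)
    have hr : 0 < r := hr
    have hS : (r • (1 : Matrix n n ℝ)) = diagonal fun _ => r := smul_one_eq_diagonal r
    have hP : (r • (1 : Matrix n n ℝ) + L).PosDef := by
      rw [hS]
      exact hpd _ fun _ => hr
    have key := det_sub_det_eq_detIncrement_mul (S := r • 1 + L) hEE hEs
      (by rw [hS]; exact hcomm _ fun _ _ _ => rfl)
      (by rw [hS]; exact IsSymm.add (isSymm_diagonal _) hLs) hP.det_pos.ne' hd hEf hEg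
    have hFr : F.eval r = ((r • 1 + L) * (1 - E) + E).detIncrement d d := by
      rw [hFdef, ← coe_evalRingHom, RingHom.map_detIncrement, polyPencil_map, hC]
      congr 1
      simp only [eval_X]
      rw [sum_smul_col, ← hS, mul_smul_comm, mul_one, smul_mul_assoc, hFs, hFF, add_mul,
        smul_mul_assoc, one_mul]
      abel
    have hGr : G.eval r = ((r • 1 + L) * E + (1 - E)).detIncrement g f := by
      rw [hGdef, ← coe_evalRingHom, RingHom.map_detIncrement, polyPencil_map, hC, hC]
      congr 1
      simp only [eval_X]
      rw [sum_smul_fiber (q := q) fun _ => r, ← hS, add_mul]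
      abel
    rw [Set.mem_ofPred_eq, eval_add, eval_mul, eval_mul, eval_C, hFr, hGr, hev, hev, ← key,
      ← add_assoc, ← add_assoc (r • (1 : Matrix n n ℝ)) L, add_sub_cancel]
  rw [hid, coeff_add, coeff_C_mul, coeff_mul]
  exact le_add_of_nonneg_right (mul_nonneg (by norm_num)
    (Finset.sum_nonneg fun p _ => mul_nonneg (hF _) (hG _)))

end Comparison

/-! ### Stars at two vertices swapped by a permutation -/

section PermutationSymmetry

variable {n : Type*} [Fintype n]

theorem Equiv.Perm.SameCycle.apply_eq_of_invariant {σ : Equiv.Perm n} {φ : n → ℝ}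
    (h : ∀ v, φ (σ v) = φ v) {v w : n} (hvw : σ.SameCycle v w) : φ v = φ w := by
  obtain ⟨k, rfl⟩ := hvw.exists_nat_pow_eq
  induction k with
  | zero => simp
  | succ k ih => rw [pow_succ', Equiv.Perm.mul_apply, h, ← ih ⟨k, by simp⟩]

variable [DecidableEq n]

/-- The edge weights of the star with center `x` in which the edge to `w` has weight `m w`. -/
def starWeight (x : n) (m : n → ℝ) (v w : n) : ℝ :=
  (if v = x then m w else 0) + (if w = x then m v else 0)

omit [Fintype n] in
theorem starWeight_comm (x : n) (m : n → ℝ) (v w : n) :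
    starWeight x m v w = starWeight x m w v :=
  add_comm _ _

omit [Fintype n] in
theorem starWeight_nonneg (x : n) {m : n → ℝ} (hm : ∀ v, 0 ≤ m v) (v w : n) :
    0 ≤ starWeight x m v w := by
  unfold starWeight
  split_ifs <;> simp [hm, add_nonneg]

omit [Fintype n] in
theorem starWeight_apply_perm (σ : Equiv.Perm n) (x : n) {m : n → ℝ} (hm : ∀ v, m (σ v) = m v)
    (v w : n) : starWeight (σ x) m (σ v) (σ w) = starWeight x m v w := by
  simp [starWeight, hm]

/-- The net flow of `m w` units from the midpoint of `x` and `y` to each `w`. -/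
noncomputable def midpointFlow (x y : n) (m : n → ℝ) : n → ℝ :=
  ((∑ w, m w) / 2) • (Pi.single x 1 + Pi.single y 1) - m

theorem Matrix.weightedLaplacian_starWeight (x : n) (m : n → ℝ) (v w : n) :
    weightedLaplacian (starWeight x m) v w
      = (∑ z, m z) * ((Pi.single x 1 : n → ℝ) v * (Pi.single x 1 : n → ℝ) w)
        + diagonal m v w - (Pi.single x 1 : n → ℝ) v * m w - m v * (Pi.single x 1 : n → ℝ) w := by
  have h : ∑ z, starWeight x m v z = (Pi.single x 1 : n → ℝ) v * (∑ z, m z) + m v := by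
    by_cases hv : v = x <;> simp [starWeight, Finset.sum_add_distrib, hv]
  simp only [weightedLaplacian, sub_apply, of_apply, diagonal_apply, h]
  unfold starWeight
  clear h
  by_cases hv : v = x <;> by_cases hw : w = x <;> by_cases hvw : v = w <;>
    simp_all

/-- The diagonal parts coming from `m` cancel. What remains is a symmetrized product of a vector odd
under the swap of `x` and `y` with one that is invariant when `m` is. -/
theorem Matrix.weightedLaplacian_starWeight_sub (x y : n) (m : n → ℝ) :
    (1 / 2 : ℝ) • (weightedLaplacian (starWeight x m) - weightedLaplacian (starWeight y m))
      = vecMulVec ((1 / 2 : ℝ) • (Pi.single x 1 - Pi.single y 1)) (midpointFlow x y m)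
        + vecMulVec (midpointFlow x y m) ((1 / 2 : ℝ) • (Pi.single x 1 - Pi.single y 1)) := by
  ext v w
  simp only [smul_apply, sub_apply, add_apply, weightedLaplacian_starWeight, vecMulVec_apply,
    midpointFlow, Pi.smul_apply, Pi.sub_apply, Pi.add_apply, smul_eq_mul]
  ring

theorem sum_midpointFlow (x y : n) (m : n → ℝ) : ∑ v, midpointFlow x y m v = 0 := by
  simp [midpointFlow, Finset.sum_sub_distrib, ← Finset.mul_sum, Finset.sum_add_distrib]

theorem midpointFlow_nonpos {x y : n} {m : n → ℝ} (hm : ∀ v, 0 ≤ m v) (v : n) (hx : v ≠ x)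
    (hy : v ≠ y) : midpointFlow x y m v ≤ 0 := by
  simp [midpointFlow, hx, hy, hm]

theorem midpointFlow_apply_perm {σ : Equiv.Perm n} {x y : n} (hx : σ x = y) (hy : σ y = x)
    {m : n → ℝ} (hm : ∀ v, m (σ v) = m v) (v : n) :
    midpointFlow x y m (σ v) = midpointFlow x y m v := by
  have h1 : σ v = x ↔ v = y := by rw [← hy, σ.apply_eq_iff_eq]
  have h2 : σ v = y ↔ v = x := by rw [← hx, σ.apply_eq_iff_eq]
  simp [midpointFlow, Pi.single_apply, h1, h2, hm, add_comm]

/-- If the weights `r`, `m`, `m'` are invariant under a permutation that swaps `x` and `y`, then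
moving the star with weights `m` from `x` to `y`, where the star with weights `m'` is attached,
does not increase any coefficient of `det (X + L)`. -/
theorem Polynomial.coeff_det_starWeight_le {σ : Equiv.Perm n} {x y : n} (hx : σ x = y)
    (hy : σ y = x) {r : n → n → ℝ} (hr : ∀ v w, r v w = r w v) (h0 : ∀ v w, 0 ≤ r v w)
    (hσ : ∀ v w, r (σ v) (σ w) = r v w) {m m' : n → ℝ} (hm : ∀ v, 0 ≤ m v) (hm' : ∀ v, 0 ≤ m' v)
    (hσm : ∀ v, m (σ v) = m v) (hσm' : ∀ v, m' (σ v) = m' v) (k : ℕ) :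
    ((X : ℝ[X]) • (1 : Matrix n n ℝ[X])
      + (weightedLaplacian (r + starWeight y m + starWeight y m')).map C).det.coeff k
    ≤ ((X : ℝ[X]) • (1 : Matrix n n ℝ[X])
      + (weightedLaplacian (r + starWeight x m + starWeight y m')).map C).det.coeff k := by
  classical
  -- Each star is shared equally between `x` and `y`: these weights are σ-invariant, and both graphs
  -- are perturbations of them.
  set r₀ : n → n → ℝ := r + ((1 / 2 : ℝ) • (starWeight x m + starWeight y m)
    + (1 / 2 : ℝ) • (starWeight x m' + starWeight y m')) with hr₀
  have hr₀s : ∀ v w, r₀ v w = r₀ w v := fun v w => by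
    simp [r₀, hr v w, starWeight_comm _ _ v w]
  have hr₀n : ∀ v w, 0 ≤ r₀ v w := fun v w => by
    have h1 := starWeight_nonneg x hm v w
    have h2 := starWeight_nonneg y hm v w
    have h3 := starWeight_nonneg x hm' v w
    have h4 := starWeight_nonneg y hm' v w
    have h5 := h0 v w
    simp only [r₀, Pi.add_apply, Pi.smul_apply, smul_eq_mul]
    positivity
  have hr₀σ : ∀ v w, r₀ (σ v) (σ w) = r₀ v w := fun v w => by
    have h1 := starWeight_apply_perm σ x hσm v w
    have h2 := starWeight_apply_perm σ y hσm v w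
    have h3 := starWeight_apply_perm σ x hσm' v w
    have h4 := starWeight_apply_perm σ y hσm' v w
    rw [hx] at h1 h3
    rw [hy] at h2 h4
    simp only [r₀, Pi.add_apply, Pi.smul_apply, h1, h2, h3, h4, hσ]
    rw [add_comm (starWeight y m v w), add_comm (starWeight y m' v w)]
  -- The fibers are the cycles of `σ`, which need not be an involution away from `x` and `y`.
  let q : n → Quotient (Equiv.Perm.SameCycle.setoid σ) := Quotient.mk _
  have hq : ∀ v w, q v = q w ↔ σ.SameCycle v w := fun v w => Quotient.eq
  have hconst : ∀ φ : n → ℝ, (∀ v, φ (σ v) = φ v) → ∀ v w, q v = q w → φ v = φ w :=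
    fun φ hφ v w h => ((hq v w).1 h).apply_eq_of_invariant hφ
  have hinv : ∀ φ : n → ℝ, (∀ v w, q v = q w → φ v = φ w) → ∀ v, φ (σ v) = φ v :=
    fun φ hφ v => hφ _ _ ((hq _ _).2 ⟨-1, by simp⟩)
  have hqxy : q x = q y := (hq x y).2 ⟨1, by simpa using hx⟩
  have hd : fiberAverage q *ᵥ ((1 / 2 : ℝ) • (Pi.single x 1 - Pi.single y 1)) = 0 := by
    ext v
    rw [fiberAverage_mulVec]
    simp only [Pi.smul_apply, Pi.sub_apply, ← Finset.smul_sum, Finset.sum_sub_distrib]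
    simp [Pi.single_apply, hqxy]
  have hL : ∀ φ : n → ℝ, (∀ v w, q v = q w → φ v = φ w) → ∀ v w, q v = q w →
      (weightedLaplacian r₀ *ᵥ φ) v = (weightedLaplacian r₀ *ᵥ φ) w := by
    intro φ hφ
    refine hconst _ fun v => ?_
    rw [weightedLaplacian_mulVec, weightedLaplacian_mulVec, ← Equiv.sum_comp σ]
    refine Finset.sum_congr rfl fun w _ => ?_
    rw [hr₀σ, hinv φ hφ, hinv φ hφ]
  have hflow : ∀ m : n → ℝ, (∀ v, m (σ v) = m v) → ∀ v w, q v = q w →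
      midpointFlow x y m v = midpointFlow x y m w := fun m hm =>
    hconst _ (midpointFlow_apply_perm hx hy hm)
  have key := coeff_det_sub_nonneg hr₀s hr₀n hL hqxy hd (hflow m hσm) (hflow m' hσm')
    (sum_midpointFlow x y m) (sum_midpointFlow x y m') (midpointFlow_nonpos hm)
    (midpointFlow_nonpos hm') k
  have hA := weightedLaplacian_starWeight_sub x y m
  have hB := weightedLaplacian_starWeight_sub x y m'
  set d : n → ℝ := (1 / 2 : ℝ) • (Pi.single x 1 - Pi.single y 1)
  set f := midpointFlow x y m
  set g := midpointFlow x y m'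
  have h1 : weightedLaplacian (r + starWeight x m + starWeight y m')
      = weightedLaplacian r₀ + (vecMulVec d (f - g) + vecMulVec (f - g) d) := by
    have : vecMulVec d (f - g) + vecMulVec (f - g) d
        = (vecMulVec d f + vecMulVec f d) - (vecMulVec d g + vecMulVec g d) := by
      rw [vecMulVec_sub, sub_vecMulVec]
      abel
    rw [this, ← hA, ← hB, hr₀]
    simp only [weightedLaplacian_add, weightedLaplacian_smul]
    module
  have h2 : weightedLaplacian (r + starWeight y m + starWeight y m')
      = weightedLaplacian r₀ + (vecMulVec d (-(f + g)) + vecMulVec (-(f + g)) d) := by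
    have : vecMulVec d (-(f + g)) + vecMulVec (-(f + g)) d
        = -(vecMulVec d f + vecMulVec f d) - (vecMulVec d g + vecMulVec g d) := by
      rw [vecMulVec_neg, neg_vecMulVec, vecMulVec_add, add_vecMulVec]
      abel
    rw [this, ← hA, ← hB, hr₀]
    simp only [weightedLaplacian_add, weightedLaplacian_smul]
    module
  rw [h1, h2]
  exact key

end PermutationSymmetry

/-- Substituting `-X` in the characteristic polynomial absorbs the alternating signs in the
definition of `c_s`. -/
theorem Matrix.coeff_det_X_add {n : Type*} [Fintype n] [DecidableEq n] (A : Matrix n n ℝ) {s : ℕ}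
    (hs : s ≤ Fintype.card n) :
    ((X : ℝ[X]) • (1 : Matrix n n ℝ[X]) + A.map C).det.coeff (Fintype.card n - s)
      = (-1) ^ s * A.charpoly.coeff (Fintype.card n - s) := by
  have h : (X : ℝ[X]) • (1 : Matrix n n ℝ[X]) + A.map C
      = -((charmatrix A).map (compRingHom (-X))) := by
    ext1 i j
    by_cases h : i = j
    · subst h
      simp [add_comm]
    · simp [h]
  have h2 : ((X : ℝ[X]) • (1 : Matrix n n ℝ[X]) + A.map C).det
      = (-1) ^ Fintype.card n * A.charpoly.comp (-X) := by
    rw [h, det_neg, charpoly, ← coe_compRingHom_apply, RingHom.map_det]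
    rfl
  have h3 : ((-1 : ℝ[X]) ^ Fintype.card n) = C ((-1) ^ Fintype.card n) := by simp
  rw [h2, h3, coeff_C_mul, show (-X : ℝ[X]) = C (-1) * X by simp, comp_C_mul_X_coeff, mul_comm (coeff _ _),
    ← mul_assoc, ← pow_add]
  congr 1
  have : Fintype.card n + (Fintype.card n - s) = s + 2 * (Fintype.card n - s) := by omega
  rw [this, pow_add, pow_mul]
  simp

end DeterminantInequality

/-! ### Edge multiplicities as a core plus two stars -/

namespace Graph

variable {α β : Type*} {G K : Graph α β} {x y : α}

open Classical in
/-- The number of edges from `z` to `w` if `w ∈ W`, and `0` otherwise. -/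
noncomputable def multiplicityOn (G : Graph α β) (z : α) (W : Set α) (w : α) : ℕ :=
  if w ∈ W then G.multiplicity z w else 0

theorem multiplicity_comm (G : Graph α β) (u v : α) : G.multiplicity u v = G.multiplicity v u := by
  simp only [multiplicity, Graph.isLink_comm]

theorem multiplicity_self (G : Graph α β) [G.Loopless] (u : α) : G.multiplicity u u = 0 := by
  simp [multiplicity]

theorem ncard_ofPred_eq_zero {p : β → Prop} (h : ∀ e, ¬ p e) : {e | p e}.ncard = 0 := by
  simp [h]

open Classical in
-- Since `z ∉ W`, an edge of `[z, W]` has exactly one end at `z`, so at most one summand is nonzero.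
theorem ncard_isLink_and_mem_edgesBetween {z : α} {W : Set α} (hz : z ∉ W) (u v : α) :
    {e | G.IsLink e u v ∧ e ∈ G.edgesBetween {z} W}.ncard
      = (if u = z then G.multiplicityOn z W v else 0)
        + (if v = z then G.multiplicityOn z W u else 0) := by
  have hempty : (∀ e, G.IsLink e u v → e ∉ G.edgesBetween {z} W) →
      {e | G.IsLink e u v ∧ e ∈ G.edgesBetween {z} W}.ncard = 0 := fun h => by
    exact ncard_ofPred_eq_zero fun e he => h e he.1 he.2
  by_cases hu : u = z
  · subst hu
    by_cases hv : v ∈ W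
    · have hvu : v ≠ u := fun h => hz (h ▸ hv)
      have : {e | G.IsLink e u v ∧ e ∈ G.edgesBetween {u} W} = {e | G.IsLink e u v} :=
        Set.ext fun e => ⟨And.left, fun h => ⟨h, u, rfl, v, hv, h⟩⟩
      rw [this]
      simp [multiplicityOn, hv, hvu, multiplicity]
    · rw [hempty]
      · simp [multiplicityOn, hv, hz]
      · rintro e he ⟨_, rfl, w, hw, h⟩
        exact hv (h.right_unique he ▸ hw)
  · by_cases hv : v = z
    · subst hv
      by_cases huW : u ∈ W
      · have : {e | G.IsLink e u v ∧ e ∈ G.edgesBetween {v} W} = {e | G.IsLink e v u} :=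
          Set.ext fun e => ⟨fun h => h.1.symm, fun h => ⟨h.symm, v, rfl, u, huW, h⟩⟩
        rw [this]
        simp [multiplicityOn, hu, huW, multiplicity]
      · rw [hempty]
        · simp [multiplicityOn, huW, hu]
        · rintro e he ⟨_, rfl, w, hw, h⟩
          exact huW (h.right_unique he.symm ▸ hw)
    · rw [hempty]
      · simp [hu, hv]
      · rintro e he ⟨_, rfl, w, hw, h⟩
        rcases h.left_eq_or_eq he with h | h
        · exact hu h.symm
        · exact hv h.symm

open Classical in
theorem ncard_isLink_redirected {z y : α} {W : Set α} (hy : y ∉ W) (u v : α) :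
    {e | ∃ w ∈ W, G.IsLink e z w ∧ ((u = y ∧ v = w) ∨ (u = w ∧ v = y))}.ncard
      = (if u = y then G.multiplicityOn z W v else 0)
        + (if v = y then G.multiplicityOn z W u else 0) := by
  by_cases hu : u = y
  · subst hu
    by_cases hv : v ∈ W
    · have hvu : v ≠ u := fun h => hy (h ▸ hv)
      have : {e | ∃ w ∈ W, G.IsLink e z w ∧ ((u = u ∧ v = w) ∨ (u = w ∧ v = u))}
          = {e | G.IsLink e z v} := Set.ext fun e => by
        constructor
        · rintro ⟨w, hw, h, ⟨-, rfl⟩ | ⟨-, h'⟩⟩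
          · exact h
          · exact absurd h' hvu
        · exact fun h => ⟨v, hv, h, Or.inl ⟨rfl, rfl⟩⟩
      rw [this]
      simp [multiplicityOn, hv, hvu, multiplicity]
    · rw [ncard_ofPred_eq_zero]
      · simp [multiplicityOn, hv, hy]
      · rintro e ⟨w, hw, h, ⟨-, rfl⟩ | ⟨rfl, -⟩⟩
        · exact hv hw
        · exact hy hw
  · by_cases hv : v = y
    · subst hv
      by_cases huW : u ∈ W
      · have : {e | ∃ w ∈ W, G.IsLink e z w ∧ ((u = v ∧ v = w) ∨ (u = w ∧ v = v))}
            = {e | G.IsLink e z u} := Set.ext fun e => by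
          constructor
          · rintro ⟨w, hw, h, ⟨h', -⟩ | ⟨rfl, -⟩⟩
            · exact absurd h' hu
            · exact h
          · exact fun h => ⟨u, huW, h, Or.inr ⟨rfl, rfl⟩⟩
        rw [this]
        simp [multiplicityOn, huW, hu, multiplicity]
      · rw [ncard_ofPred_eq_zero]
        · simp [multiplicityOn, huW, hu]
        · rintro e ⟨w, hw, h, ⟨h', -⟩ | ⟨rfl, -⟩⟩
          · exact hu h'
          · exact huW hw
    · rw [ncard_ofPred_eq_zero]
      · simp [hu, hv]
      · rintro e ⟨w, hw, h, ⟨h', -⟩ | ⟨-, h'⟩⟩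
        · exact hu h'
        · exact hv h'

theorem notMem_privateNbrs {z : α} (hz : z ∈ V(K)) : z ∉ G.privateNbrs K x y :=
  fun h => h.2 (Or.inl hz)

/-- A common edge would join `x` to `y` and put `x` into `Y`, which avoids `V(K)`. -/
theorem disjoint_edgesBetween_privateNbrs (hx : x ∈ V(K)) (hxy : x ≠ y) :
    Disjoint (G.edgesBetween {x} (G.privateNbrs K x y))
      (G.edgesBetween {y} (G.privateNbrs K y x)) := by
  rw [Set.disjoint_left]
  rintro e ⟨_, rfl, w, hw, h⟩ ⟨_, rfl, z, hz, h'⟩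
  rcases h.left_eq_or_eq h' with h | rfl
  · exact hxy h
  · exact notMem_privateNbrs hx hz

/-- `G - ([x,X] ∪ [y,Y])`. -/
def privateCore (G K : Graph α β) (x y : α) : Graph α β :=
  G.deleteEdges (G.edgesBetween {x} (G.privateNbrs K x y) ∪
      G.edgesBetween {y} (G.privateNbrs K y x))

theorem ncard_isLink_notMem_edgesBetween (hE : E(G).Finite) (hx : x ∈ V(K)) (hxy : x ≠ y)
    (u v : α) :
    {e | e ∉ G.edgesBetween {x} (G.privateNbrs K x y) ∧ G.IsLink e u v}.ncard
      = (G.privateCore K x y).multiplicity u v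
        + {e | G.IsLink e u v ∧ e ∈ G.edgesBetween {y} (G.privateNbrs K y x)}.ncard := by
  have hfin : ∀ p : β → Prop, (∀ e, p e → G.IsLink e u v) → {e | p e}.Finite := fun p hp =>
    hE.subset fun e he => (hp e he).edge_mem
  rw [multiplicity, ← Set.ncard_union_eq ?_ ?_ ?_]
  · congr 1
    ext e
    have : e ∈ G.edgesBetween {x} (G.privateNbrs K x y) →
        e ∉ G.edgesBetween {y} (G.privateNbrs K y x) := fun h =>
      Set.disjoint_left.1 (disjoint_edgesBetween_privateNbrs hx hxy) h
    simp only [privateCore, deleteEdges_isLink, Set.mem_union, Set.mem_ofPred_eq]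
    tauto
  · rw [Set.disjoint_left]
    rintro e he ⟨-, he'⟩
    simp only [privateCore, deleteEdges_isLink, Set.mem_union, Set.mem_ofPred_eq] at he
    tauto
  · exact hfin _ fun e he => by
      simp only [privateCore, deleteEdges_isLink] at he
      exact he.1
  · exact hfin _ fun e he => he.1

open Classical in
theorem multiplicity_eq_add (hE : E(G).Finite) (hx : x ∈ V(K)) (hy : y ∈ V(K)) (hxy : x ≠ y)
    (u v : α) :
    G.multiplicity u v = (G.privateCore K x y).multiplicity u v
      + ((if u = x then G.multiplicityOn x (G.privateNbrs K x y) v else 0)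
        + (if v = x then G.multiplicityOn x (G.privateNbrs K x y) u else 0))
      + ((if u = y then G.multiplicityOn y (G.privateNbrs K y x) v else 0)
        + (if v = y then G.multiplicityOn y (G.privateNbrs K y x) u else 0)) := by
  rw [← ncard_isLink_and_mem_edgesBetween (notMem_privateNbrs hx),
    ← ncard_isLink_and_mem_edgesBetween (notMem_privateNbrs hy), add_right_comm,
    ← ncard_isLink_notMem_edgesBetween hE hx hxy, ← Set.ncard_union_eq ?_ ?_ ?_, multiplicity]
  · congr 1
    ext e
    simp only [Set.mem_union, Set.mem_ofPred_eq]
    tauto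
  · rw [Set.disjoint_left]
    rintro e he he'
    exact he.1 he'.2
  · exact hE.subset fun e he => he.2.edge_mem
  · exact hE.subset fun e he => he.1.edge_mem

open Classical in
theorem multiplicity_kOperation_eq_add (hE : E(G).Finite) (hx : x ∈ V(K)) (hy : y ∈ V(K))
    (hxy : x ≠ y) (hyG : y ∈ V(G)) (u v : α) :
    (G.kOperation K x y hyG).multiplicity u v = (G.privateCore K x y).multiplicity u v
      + ((if u = y then G.multiplicityOn x (G.privateNbrs K x y) v else 0)
        + (if v = y then G.multiplicityOn x (G.privateNbrs K x y) u else 0))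
      + ((if u = y then G.multiplicityOn y (G.privateNbrs K y x) v else 0)
        + (if v = y then G.multiplicityOn y (G.privateNbrs K y x) u else 0)) := by
  rw [← ncard_isLink_redirected (notMem_privateNbrs hy),
    ← ncard_isLink_and_mem_edgesBetween (notMem_privateNbrs hy), add_right_comm,
    ← ncard_isLink_notMem_edgesBetween hE hx hxy, ← Set.ncard_union_eq ?_ ?_ ?_, multiplicity]
  · rfl
  · rw [Set.disjoint_left]
    rintro e he ⟨w, hw, h, -⟩
    exact he.1 ⟨x, rfl, w, hw, h⟩
  · exact hE.subset fun e he => he.2.edge_mem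
  · exact hE.subset fun e ⟨w, hw, h, _⟩ => h.edge_mem

theorem kOperation_loopless [G.Loopless] (hy : y ∈ V(K)) (hyG : y ∈ V(G)) :
    (G.kOperation K x y hyG).Loopless where
  not_isLoopAt e u h := by
    rcases h with ⟨-, h⟩ | ⟨w, hw, -, ⟨rfl, rfl⟩ | ⟨rfl, rfl⟩⟩
    · exact G.not_isLoopAt e u h
    · exact notMem_privateNbrs hy hw
    · exact notMem_privateNbrs hy hw

theorem multiplicity_map_of_bijOn {H : Graph α β} {f : α → α} {g : β → β}
    (hg : Set.BijOn g E(H) E(H))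
    (hfg : ∀ e ∈ E(H), ∀ u ∈ V(H), ∀ v ∈ V(H), H.IsLink e u v ↔ H.IsLink (g e) (f u) (f v))
    {u v : α} (hu : u ∈ V(H)) (hv : v ∈ V(H)) :
    H.multiplicity (f u) (f v) = H.multiplicity u v := by
  have : {e | H.IsLink e (f u) (f v)} = g '' {e | H.IsLink e u v} := by
    ext e
    constructor
    · intro he
      obtain ⟨e', he', rfl⟩ := hg.surjOn he.edge_mem
      exact ⟨e', (hfg e' he' u hu v hv).2 he, rfl⟩
    · rintro ⟨e', he', rfl⟩
      exact (hfg e' he'.edge_mem u hu v hv).1 he'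
  rw [multiplicity, this, Set.InjOn.ncard_image (hg.injOn.mono fun e he => he.edge_mem)]
  rfl

open Classical in
theorem laplacianMatrix_eq_weightedLaplacian (G : Graph α β) [G.Loopless] [Fintype V(G)]
    (hE : E(G).Finite) :
    G.laplacianMatrix = Matrix.weightedLaplacian fun u v : V(G) => (G.multiplicity u v : ℝ) := by
  ext u v
  have h : ∑ w : V(G), (G.multiplicity u w : ℝ) = G.vertexDegree u := by
    exact_mod_cast sum_multiplicity G hE u
  by_cases huv : u = v
  · subst huv
    simp [laplacianMatrix, Matrix.weightedLaplacian, h, multiplicity_self]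
  · simp [laplacianMatrix, Matrix.weightedLaplacian, huv]

open Classical Polynomial in
theorem laplacianCoeff_eq_coeff_det (G : Graph α β) [G.Loopless] [Fintype V(G)]
    (hE : E(G).Finite) {s : ℕ} (hs : s < V(G).ncard) :
    G.laplacianCoeff s = ((X : ℝ[X]) • (1 : Matrix V(G) V(G) ℝ[X])
      + (Matrix.weightedLaplacian fun u v : V(G) => (G.multiplicity u v : ℝ)).map C).det.coeff
        (Fintype.card V(G) - s) := by
  have hcard : V(G).ncard = Fintype.card V(G) := by
    rw [← Nat.card_coe_set_eq, Nat.card_eq_fintype_card]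
  rw [Matrix.coeff_det_X_add _ (hcard ▸ hs.le), ← laplacianMatrix_eq_weightedLaplacian G hE,
    laplacianCoeff, laplacianPolynomial, coeff_divX, laplacianCharpoly, ← hcard,
    -- Division by `λ` shifts the index by one; `s < n` keeps the truncated subtraction exact.
    show V(G).ncard - 1 - s + 1 = V(G).ncard - s by omega]
  congr!

end Graph

theorem mainTheorem1 {α β : Type*} (G K : Graph α β) [G.Loopless] [Finite V(G)]
    (hE : E(G).Finite) (hK : K ≤i G) (x y : α) (hx : x ∈ V(K)) (hy : y ∈ V(K)) (hxy : x ≠ y)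
    (hsymm : G.IsSymmetricKOperation K x y) (s : ℕ) (hs : s < V(G).ncard) :
    (G.kOperation K x y (hK.le.vertexSet_mono hy)).laplacianCoeff s ≤ G.laplacianCoeff s := by
  classical
  have hxG : x ∈ V(G) := hK.le.vertexSet_mono hx
  have hyG : y ∈ V(G) := hK.le.vertexSet_mono hy
  obtain ⟨f, ⟨hf, g, hg, hfg⟩, hfx, hfy, -, hfix⟩ := hsymm
  let _ : Fintype V(G) := Fintype.ofFinite _
  let _ : Fintype V(G.kOperation K x y hyG) := inferInstanceAs (Fintype V(G))
  have := Graph.kOperation_loopless (G := G) (x := x) hy hyG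
  let σ : Equiv.Perm V(G) := Set.BijOn.equiv f hf
  have hσ : ∀ v, (σ v : α) = f v := fun v => rfl
  let mX : V(G) → ℝ := fun v => G.multiplicityOn x (G.privateNbrs K x y) v
  let mY : V(G) → ℝ := fun v => G.multiplicityOn y (G.privateNbrs K y x) v
  let r : V(G) → V(G) → ℝ := fun u v => (G.privateCore K x y).multiplicity u v
  have hinv : ∀ (z : α) (W : Set α), (∀ v ∈ W, f v = v) → ∀ v : V(G),
      (G.multiplicityOn z W (σ v) : ℝ) = G.multiplicityOn z W v := by
    intro z W hW v
    by_cases hv : (v : α) ∈ W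
    · rw [hσ, hW v hv]
    · have hv' : (σ v : α) ∉ W := fun h => hv (by
        have h1 : (σ (σ v) : α) = σ v := hW _ h
        rw [σ.injective (Subtype.ext h1)] at h
        exact h)
      simp [Graph.multiplicityOn, hv, hv']
  have key := Polynomial.coeff_det_starWeight_le (σ := σ) (x := ⟨x, hxG⟩) (y := ⟨y, hyG⟩)
    (Subtype.ext hfx) (Subtype.ext hfy) (r := r)
    (fun u v => congrArg Nat.cast (Graph.multiplicity_comm _ _ _)) (fun _ _ => Nat.cast_nonneg _)
    (fun u v => congrArg Nat.cast (Graph.multiplicity_map_of_bijOn hg hfg u.2 v.2))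
    (m := mX) (m' := mY) (fun _ => Nat.cast_nonneg _) (fun _ => Nat.cast_nonneg _)
    (hinv _ _ fun v hv => hfix v (Or.inl hv)) (hinv _ _ fun v hv => hfix v (Or.inr hv))
    (Fintype.card V(G) - s)
  -- The two graphs share the core and the `Y`-star; only the center of the `X`-star differs.
  have hG : (fun u v : V(G) => (G.multiplicity u v : ℝ))
      = r + starWeight ⟨x, hxG⟩ mX + starWeight ⟨y, hyG⟩ mY := by
    ext u v
    rw [Graph.multiplicity_eq_add hE hx hy hxy]
    simp [r, mX, mY, starWeight, Subtype.ext_iff]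
  have hG' : (fun u v : V(G) => ((G.kOperation K x y hyG).multiplicity u v : ℝ))
      = r + starWeight ⟨y, hyG⟩ mX + starWeight ⟨y, hyG⟩ mY := by
    ext u v
    rw [Graph.multiplicity_kOperation_eq_add hE hx hy hxy]
    simp [r, mX, mY, starWeight, Subtype.ext_iff]
  rw [← hG, ← hG'] at key
  rw [Graph.laplacianCoeff_eq_coeff_det G hE hs,
    Graph.laplacianCoeff_eq_coeff_det (G.kOperation K x y hyG) hE hs]
  exact key
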